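/- Let $\mathcal X,\mathcal U,\mathcal Y$ be complex Hilbert spaces and let $\left[\begin{smallmatrix}A\&B\\ C\&D\end{smallmatrix}\right]$ be a system node on $(\mathcal X,\mathcal U,\mathcal Y)$: $A\&B:\mathcal X\times\mathcal U\supset\operatorname{dom}(A\&B)\to\mathcal X$ is a closed linear operator; $C\&D:\operatorname{dom}(A\&B)\to\mathcal Y$ is linear and bounded with respect to the graph norm of $A\&B$; for every $u\in\mathcal U$ there is $x\in\mathcal X$ with $\binom xu\in\operatorname{dom}(A\&B)$; and the main operator $x\mapsto A\&B\binom x0$, with domain $\{x:\binom x0\in\operatorname{dom}(A\&B)\}$, generates a strongly continuous semigroup on $\mathcal X$. A classical trajectory on $[0,T]$ ($T>0$) is a triple $(x,u,y)\in C^1([0,T];\mathcal X)\times C([0,T];\mathcal U)\times C([0,T];\mathcal Y)$ with $\binom{x(t)}{u(t)}\in\operatorname{dom}(A\&B)$, $\dot x(t)=A\&B\binom{x(t)}{u(t)}$ and $y(t)=C\&D\binom{x(t)}{u(t)}$ for all $t\in[0,T]$. A generalized trajectory on $[0,T]$ is a limit of classical trajectories on $[0,T]$ in $C([0,T];\mathcal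 X)\times L^2([0,T];\mathcal U)\times L^2([0,T];\mathcal Y)$. A generalized trajectory on $\mathbb R_{\ge0}$ is a triple of functions on $\mathbb R_{\ge0}$ whose restriction to $[0,T]$ is a generalized trajectory on $[0,T]$ for every $T>0$. A system node is infinite-time well-posed if there is a constant $c$ such that, for all $T>0$, all its classical trajectories on $[0,T]$ satisfy $\|x(T)\|+\|y\|_{L^2([0,T])}\le c\,(\|x(0)\|+\|u\|_{L^2([0,T])})$. The given system node is state-feedback stabilizable if there is a linear map $F\&G:\operatorname{dom}(A\&B)\to\mathcal U$, bounded with respect to the graph norm, such that $M\binom xu=\binom{x}{u-F\&G\binom xu}$ is injective on $\operatorname{dom}(A\&B)$ and the closed loop $\left[\begin{smallmatrix}A\&B\\ C\&D\\ F\&G\end{smallmatrix}\right]M^{-1}$, with domain $M\operatorname{dom}(A\&B)$, is an infinite-time well-posed system node on $(\mathcal X,\mathcal U,\mathcal Y\times\mathcal U)$. Let $Q=Q^*$ and $R=R^*$ be bounded operators on $\mathcal Y$ and $\mathcal U$, let $S:\mathcal U\to\mathcal Y$ be bounded and linear, and put $$s(y,u)=\left\langle\binom yu,\begin{bmatrix}Q&S\\S^*&R\end{bmatrix}\binom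 yu\right\rangle_{\mathcal Y\times\mathcal U}.$$ Assume that $s(y,u)\ge0$ for all $y\in\mathcal Y$, $u\in\mathcal U$, and that the system node is state-feedback stabilizable. Define $\mathrm{Val}:\mathcal X\to[0,\infty]$ by $$\mathrm{Val}(x_0)=\inf\Big\{\int_0^\infty s(y(t),u(t))\,dt \;:\; (x,u,y)\text{ is a generalized trajectory on }\mathbb R_{\ge0}\text{ with }x(0)=x_0\Big\}.$$ **Proposition 5.5.** Let $(x,u,y)$ be a generalized trajectory on $\mathbb R_{\ge0}$ with $u\in L^2(\mathbb R_{\ge0};\mathcal U)$ and $y\in L^2(\mathbb R_{\ge0};\mathcal Y)$. Then $\lim_{t\to\infty}\mathrm{Val}(x(t))=0$. -/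

import Mathlib

open Set Filter Topology MeasureTheory
open scoped NNReal ENNReal

noncomputable section

namespace SysNode

section Semigroup

variable {X : Type*} [NormedAddCommGroup X] [InnerProductSpace ℂ X]

/-- The family `S` of bounded operators, indexed by `t ≥ 0`, is a strongly continuous semigroup. -/
structure IsC0Semigroup (S : ℝ≥0 → X →L[ℂ] X) : Prop where
  map_zero : S 0 = ContinuousLinearMap.id ℂ X
  map_add : ∀ s t : ℝ≥0, S (s + t) = (S s).comp (S t)
  continuous_orbit : ∀ x : X, Continuous fun t : ℝ≥0 => S t x

/-- `A` is the (infinitesimal) generator of `S`: the domain of `A` consists of exactly those `x`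
for which the limit of `(S h x - x) / h` as `h ↓ 0` exists, and `A x` is this limit. -/
def IsGenerator (S : ℝ≥0 → X →L[ℂ] X) (A : X →ₗ.[ℂ] X) : Prop :=
  ∀ x z : X, (x, z) ∈ A.graph ↔
    Tendsto (fun h : ℝ≥0 => (h : ℝ)⁻¹ • (S h x - x)) (𝓝[>] 0) (𝓝 z)

end Semigroup

section Node

variable {X U Y Z : Type*}
  [NormedAddCommGroup X] [InnerProductSpace ℂ X]
  [NormedAddCommGroup U] [InnerProductSpace ℂ U]
  [NormedAddCommGroup Y] [InnerProductSpace ℂ Y]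
  [NormedAddCommGroup Z] [InnerProductSpace ℂ Z]

/-- The graph norm on the domain of an operator `AB` from `X × U` to `X`, where `X × U` carries its
Hilbert space norm. -/
def graphNorm (AB : X × U →ₗ.[ℂ] X) (w : AB.domain) : ℝ :=
  √(‖(w : X × U).1‖ ^ 2 + ‖(w : X × U).2‖ ^ 2 + ‖AB w‖ ^ 2)

/-- Boundedness of a linear map on the domain of `AB`, with respect to the graph norm of `AB`. -/
def IsGraphBounded (AB : X × U →ₗ.[ℂ] X) (L : AB.domain →ₗ[ℂ] Z) : Prop :=
  ∃ c : ℝ, ∀ w : AB.domain, ‖L w‖ ≤ c * graphNorm AB w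

/-- The main operator: its domain is `{x | (x, 0) ∈ dom AB}`, and it maps `x` to `AB (x, 0)`. -/
def mainOperator (AB : X × U →ₗ.[ℂ] X) : X →ₗ.[ℂ] X where
  domain := AB.domain.comap (LinearMap.inl ℂ X U)
  toFun := AB.toFun ∘ₗ (LinearMap.inl ℂ X U).submoduleComap AB.domain

end Node

/-- A system node on `(X, U, Y)`. The fields `AB` and `CD` are the operators `A&B` and `C&D`; both
have the same domain, a subspace of `X × U`. (Closedness only depends on the product topology.) -/
structure SystemNode (X U Y : Type*)
    [NormedAddCommGroup X] [InnerProductSpace ℂ X]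
    [NormedAddCommGroup U] [InnerProductSpace ℂ U]
    [NormedAddCommGroup Y] [InnerProductSpace ℂ Y] where
  AB : X × U →ₗ.[ℂ] X
  CD : AB.domain →ₗ[ℂ] Y
  isClosed_AB : AB.IsClosed
  bounded_CD : IsGraphBounded AB CD
  exists_state : ∀ u : U, ∃ x : X, (x, u) ∈ AB.domain
  exists_semigroup : ∃ S : ℝ≥0 → X →L[ℂ] X, IsC0Semigroup S ∧ IsGenerator S (mainOperator AB)

section Trajectories

variable {X U Y : Type*}
  [NormedAddCommGroup X] [InnerProductSpace ℂ X]
  [NormedAddCommGroup U] [InnerProductSpace ℂ U]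
  [NormedAddCommGroup Y] [InnerProductSpace ℂ Y]

/-- Classical trajectories on `[0, T]`. Only the values of `x`, `u`, `y` on `[0, T]` matter. -/
structure IsClassicalTrajectoryOn (N : SystemNode X U Y) (T : ℝ)
    (x : ℝ → X) (u : ℝ → U) (y : ℝ → Y) : Prop where
  contDiffOn_state : ContDiffOn ℝ 1 x (Icc 0 T)
  continuousOn_input : ContinuousOn u (Icc 0 T)
  continuousOn_output : ContinuousOn y (Icc 0 T)
  equation : ∀ t ∈ Icc 0 T, ∃ h : (x t, u t) ∈ N.AB.domain,
    HasDerivWithinAt x (N.AB ⟨(x t, u t), h⟩) (Icc 0 T) t ∧ y t = N.CD ⟨(x t, u t), h⟩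

/-- Generalized trajectories on `[0, T]`: limits of classical trajectories on `[0, T]` in
`C([0, T]; X) × L²([0, T]; U) × L²([0, T]; Y)`. Elements of `L²` are given by representatives. -/
structure IsGeneralizedTrajectoryOn (N : SystemNode X U Y) (T : ℝ)
    (x : ℝ → X) (u : ℝ → U) (y : ℝ → Y) : Prop where
  continuousOn_state : ContinuousOn x (Icc 0 T)
  memLp_input : MemLp u 2 (volume.restrict (Icc 0 T))
  memLp_output : MemLp y 2 (volume.restrict (Icc 0 T))
  isLimit : ∃ (xn : ℕ → ℝ → X) (un : ℕ → ℝ → U) (yn : ℕ → ℝ → Y),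
    (∀ n, IsClassicalTrajectoryOn N T (xn n) (un n) (yn n)) ∧
    TendstoUniformlyOn xn x atTop (Icc 0 T) ∧
    Tendsto (fun n => eLpNorm (un n - u) 2 (volume.restrict (Icc 0 T))) atTop (𝓝 0) ∧
    Tendsto (fun n => eLpNorm (yn n - y) 2 (volume.restrict (Icc 0 T))) atTop (𝓝 0)

/-- Generalized trajectories on `[0, ∞)`. Only the values of `x`, `u`, `y` on `[0, ∞)` matter. -/
def IsGeneralizedTrajectory (N : SystemNode X U Y)
    (x : ℝ → X) (u : ℝ → U) (y : ℝ → Y) : Prop :=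
  ∀ T : ℝ, 0 < T → IsGeneralizedTrajectoryOn N T x u y

/-- Infinite-time well-posedness: the well-posedness estimate on `[0, T]` holds for all classical
trajectories, with a constant that does not depend on `T`. -/
def IsInfiniteTimeWellPosed (N : SystemNode X U Y) : Prop :=
  ∃ c : ℝ≥0, ∀ T : ℝ, 0 < T → ∀ (x : ℝ → X) (u : ℝ → U) (y : ℝ → Y),
    IsClassicalTrajectoryOn N T x u y →
      ‖x T‖ₑ + eLpNorm y 2 (volume.restrict (Icc 0 T)) ≤
        c * (‖x 0‖ₑ + eLpNorm u 2 (volume.restrict (Icc 0 T)))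

/-- The operator `(x, u) ↦ (x, u - FG (x, u))` on the domain of `A&B`; it expresses the external
input `v = u - z` of the closed loop, where `z = FG (x, u)`. -/
def feedbackMap (N : SystemNode X U Y) (FG : N.AB.domain →ₗ[ℂ] U) : N.AB.domain →ₗ[ℂ] X × U :=
  N.AB.domain.subtype - LinearMap.inr ℂ X U ∘ₗ FG

/-- `FG` is an admissible state feedback for `N`, and `K` is the resulting closed-loop system node,
with input `v` and output `(y, z)`: `FG` is bounded on `dom(A&B)`, the operator
`M = feedbackMap N FG` is a bijection from `dom(A&B)` onto the domain of the closed loop, and the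
closed-loop operators are `A&B`, `C&D`, `FG` composed with the inverse of `M`. -/
structure IsClosedLoop (N : SystemNode X U Y) (FG : N.AB.domain →ₗ[ℂ] U)
    (K : SystemNode X U (WithLp 2 (Y × U))) : Prop where
  bounded_FG : IsGraphBounded N.AB FG
  injective : Function.Injective (feedbackMap N FG)
  range_eq : LinearMap.range (feedbackMap N FG) = K.AB.domain
  state_eq : ∀ (w : N.AB.domain) (h : feedbackMap N FG w ∈ K.AB.domain),
    K.AB ⟨feedbackMap N FG w, h⟩ = N.AB w
  output_eq : ∀ (w : N.AB.domain) (h : feedbackMap N FG w ∈ K.AB.domain),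
    K.CD ⟨feedbackMap N FG w, h⟩ = WithLp.toLp 2 (N.CD w, FG w)

/-- State-feedback stabilizability: some admissible state feedback yields an infinite-time
well-posed closed-loop system. -/
def IsStateFeedbackStabilizable (N : SystemNode X U Y) : Prop :=
  ∃ (FG : N.AB.domain →ₗ[ℂ] U) (K : SystemNode X U (WithLp 2 (Y × U))),
    IsClosedLoop N FG K ∧ IsInfiniteTimeWellPosed K

end Trajectories

section Cost

variable {X U Y : Type*}
  [NormedAddCommGroup X] [InnerProductSpace ℂ X]
  [NormedAddCommGroup U] [InnerProductSpace ℂ U] [CompleteSpace U]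
  [NormedAddCommGroup Y] [InnerProductSpace ℂ Y] [CompleteSpace Y]

/-- The supply rate `s(y, u) = ⟨(y, u), [Q S; S* R] (y, u)⟩` on `Y × U`. The inner product is real
for self-adjoint `Q`, `R`. -/
def supplyRate (Q : Y →L[ℂ] Y) (S : U →L[ℂ] Y) (R : U →L[ℂ] U) (y : Y) (u : U) : ℝ :=
  (inner ℂ y (Q y + S u) + inner ℂ u (ContinuousLinearMap.adjoint S y + R u)).re

/-- The cost `∫₀^∞ s(y(t), u(t)) dt ∈ [0, ∞]`, for nonnegative supply rates `s`. -/
def cost (Q : Y →L[ℂ] Y) (S : U →L[ℂ] Y) (R : U →L[ℂ] U) (y : ℝ → Y) (u : ℝ → U) : ℝ≥0∞ :=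
  ∫⁻ t in Ici (0 : ℝ), ENNReal.ofReal (supplyRate Q S R (y t) (u t))

/-- The value function: the infimum in `[0, ∞]` of the cost over all generalized trajectories on
`[0, ∞)` that start at `x₀`. -/
def Val (N : SystemNode X U Y) (Q : Y →L[ℂ] Y) (S : U →L[ℂ] Y) (R : U →L[ℂ] U) (x₀ : X) : ℝ≥0∞ :=
  sInf {J : ℝ≥0∞ | ∃ (x : ℝ → X) (u : ℝ → U) (y : ℝ → Y),
    IsGeneralizedTrajectory N x u y ∧ x 0 = x₀ ∧ J = cost Q S R y u}

end Cost

end SysNode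

end

/-!
A trajectory restarted at time `a` is a competitor for the initial state `x a`. Hence `Val (x a)` is
at most the cost accumulated on `[a, ∞)`, which is the tail of a convergent integral.
-/

namespace SysNode

section Measure

variable {α β E : Type*} [MeasurableSpace α] [MeasurableSpace β] {μ : Measure α} {ν : Measure β}

lemma map_restrict_le_restrict_of_mapsTo {φ : α → β} (hφ : MeasurePreserving φ μ ν) {s : Set α}
    {t : Set β} (ht : MeasurableSet t) (hst : MapsTo φ s t) :
    (μ.restrict s).map φ ≤ ν.restrict t :=
  calc (μ.restrict s).map φ
      ≤ (μ.restrict (φ ⁻¹' t)).map φ :=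
        Measure.map_mono (Measure.restrict_mono_set μ hst) hφ.measurable
    _ = ν.restrict t := (hφ.restrict_preimage ht).map_eq

lemma memLp_comp_of_mapsTo [NormedAddCommGroup E] {φ : α → β} (hφ : MeasurePreserving φ μ ν)
    {s : Set α} {t : Set β} (ht : MeasurableSet t) (hst : MapsTo φ s t) {p : ℝ≥0∞} {f : β → E}
    (hf : MemLp f p (ν.restrict t)) : MemLp (f ∘ φ) p (μ.restrict s) :=
  (hf.mono_measure (map_restrict_le_restrict_of_mapsTo hφ ht hst)).comp_of_map
    hφ.measurable.aemeasurable

lemma eLpNorm_comp_le_of_mapsTo [NormedAddCommGroup E] {φ : α → β} (hφ : MeasurePreserving φ μ ν)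
    (hemb : MeasurableEmbedding φ) {s : Set α} {t : Set β} (ht : MeasurableSet t)
    (hst : MapsTo φ s t) (p : ℝ≥0∞) (f : β → E) :
    eLpNorm (f ∘ φ) p (μ.restrict s) ≤ eLpNorm f p (ν.restrict t) :=
  calc eLpNorm (f ∘ φ) p (μ.restrict s)
      = eLpNorm f p ((μ.restrict s).map φ) := hemb.eLpNorm_map_measure.symm
    _ ≤ eLpNorm f p (ν.restrict t) :=
        eLpNorm_mono_measure f (map_restrict_le_restrict_of_mapsTo hφ ht hst)

lemma integrable_inner_of_memLp (𝕜 : Type*) [RCLike 𝕜] [NormedAddCommGroup E]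
    [InnerProductSpace 𝕜 E] {f g : α → E} (hf : MemLp f 2 μ) (hg : MemLp g 2 μ) :
    Integrable (fun t => inner 𝕜 (f t) (g t)) μ :=
  (L2.integrable_inner (𝕜 := 𝕜) (hf.toLp f) (hg.toLp g)).congr <| by
    filter_upwards [hf.coeFn_toLp, hg.coeFn_toLp] with t hft hgt
    rw [hft, hgt]

lemma tendsto_setIntegral_Ici_atTop [NormedAddCommGroup E] [NormedSpace ℝ E] [LinearOrder α]
    [NoMaxOrder α] [(atTop : Filter α).IsCountablyGenerated] [TopologicalSpace α]
    [OrderClosedTopology α] [OpensMeasurableSpace α] {f : α → E} {a : α}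
    (hf : IntegrableOn f (Ici a) μ) :
    Tendsto (fun t => ∫ s in Ici t, f s ∂μ) atTop (𝓝 0) := by
  have hempty : ⋂ t : α, Ici t = ∅ := by
    ext s
    simpa using exists_gt s
  simpa only [hempty, setIntegral_empty] using
    tendsto_setIntegral_of_antitone (fun _ => measurableSet_Ici) antitone_Ici ⟨a, hf⟩

end Measure

section TimeTranslation

lemma mapsTo_const_add_Icc {a : ℝ} (ha : 0 ≤ a) (T : ℝ) :
    MapsTo (a + ·) (Icc 0 T) (Icc 0 (a + T)) :=
  fun _ hs => ⟨add_nonneg ha hs.1, add_le_add_right hs.2 a⟩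

lemma memLp_comp_const_add_Icc {E : Type*} [NormedAddCommGroup E] {f : ℝ → E} {p : ℝ≥0∞} {a T : ℝ}
    (ha : 0 ≤ a) (hf : MemLp f p (volume.restrict (Icc 0 (a + T)))) :
    MemLp (fun s => f (a + s)) p (volume.restrict (Icc 0 T)) :=
  memLp_comp_of_mapsTo (measurePreserving_add_left volume a) measurableSet_Icc
    (mapsTo_const_add_Icc ha T) hf

lemma tendsto_eLpNorm_sub_comp_const_add_Icc {ι E : Type*} [NormedAddCommGroup E] {l : Filter ι}
    {fn : ι → ℝ → E} {f : ℝ → E} {p : ℝ≥0∞} {a T : ℝ} (ha : 0 ≤ a)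
    (hf : Tendsto (fun n => eLpNorm (fn n - f) p (volume.restrict (Icc 0 (a + T)))) l (𝓝 0)) :
    Tendsto (fun n => eLpNorm ((fun s => fn n (a + s)) - fun s => f (a + s)) p
      (volume.restrict (Icc 0 T))) l (𝓝 0) :=
  tendsto_of_tendsto_of_tendsto_of_le_of_le tendsto_const_nhds hf (fun _ => zero_le) fun n =>
    eLpNorm_comp_le_of_mapsTo (measurePreserving_add_left volume a) (measurableEmbedding_addLeft a)
      measurableSet_Icc (mapsTo_const_add_Icc ha T) p (fn n - f)

variable {X U Y : Type*}
  [NormedAddCommGroup X] [InnerProductSpace ℂ X]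
  [NormedAddCommGroup U] [InnerProductSpace ℂ U]
  [NormedAddCommGroup Y] [InnerProductSpace ℂ Y]
  {N : SystemNode X U Y} {x : ℝ → X} {u : ℝ → U} {y : ℝ → Y} {a T : ℝ}

lemma IsClassicalTrajectoryOn.comp_const_add (ha : 0 ≤ a)
    (h : IsClassicalTrajectoryOn N (a + T) x u y) :
    IsClassicalTrajectoryOn N T (fun s => x (a + s)) (fun s => u (a + s))
      (fun s => y (a + s)) where
  contDiffOn_state := h.contDiffOn_state.comp (by fun_prop) (mapsTo_const_add_Icc ha T)
  continuousOn_input := h.continuousOn_input.comp (by fun_prop) (mapsTo_const_add_Icc ha T)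
  continuousOn_output := h.continuousOn_output.comp (by fun_prop) (mapsTo_const_add_Icc ha T)
  equation t ht := by
    obtain ⟨hdom, hderiv, hout⟩ := h.equation (a + t) (mapsTo_const_add_Icc ha T ht)
    have hshift : HasDerivWithinAt (a + ·) 1 (Icc 0 T) t := (hasDerivWithinAt_id t _).const_add a
    refine ⟨hdom, ?_, hout⟩
    simpa only [Function.comp_def, one_smul] using
      hderiv.scomp t hshift (mapsTo_const_add_Icc ha T)

lemma IsGeneralizedTrajectoryOn.comp_const_add (ha : 0 ≤ a)
    (h : IsGeneralizedTrajectoryOn N (a + T) x u y) :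
    IsGeneralizedTrajectoryOn N T (fun s => x (a + s)) (fun s => u (a + s))
      (fun s => y (a + s)) where
  continuousOn_state := h.continuousOn_state.comp (by fun_prop) (mapsTo_const_add_Icc ha T)
  memLp_input := memLp_comp_const_add_Icc ha h.memLp_input
  memLp_output := memLp_comp_const_add_Icc ha h.memLp_output
  isLimit := by
    obtain ⟨xn, un, yn, hclassical, hx, hu, hy⟩ := h.isLimit
    exact ⟨_, _, _, fun n => (hclassical n).comp_const_add ha,
      (hx.comp (a + ·)).mono (mapsTo_const_add_Icc ha T),
      tendsto_eLpNorm_sub_comp_const_add_Icc ha hu, tendsto_eLpNorm_sub_comp_const_add_Icc ha hy⟩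

lemma IsGeneralizedTrajectory.comp_const_add (ha : 0 ≤ a) (h : IsGeneralizedTrajectory N x u y) :
    IsGeneralizedTrajectory N (fun s => x (a + s)) (fun s => u (a + s)) (fun s => y (a + s)) :=
  fun T hT => (h (a + T) (add_pos_of_nonneg_of_pos ha hT)).comp_const_add ha

end TimeTranslation

section Cost

variable {X U Y : Type*}
  [NormedAddCommGroup X] [InnerProductSpace ℂ X]
  [NormedAddCommGroup U] [InnerProductSpace ℂ U] [CompleteSpace U]
  [NormedAddCommGroup Y] [InnerProductSpace ℂ Y] [CompleteSpace Y]
  (Q : Y →L[ℂ] Y) (S : U →L[ℂ] Y) (R : U →L[ℂ] U)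

lemma integrable_supplyRate {α : Type*} [MeasurableSpace α] {μ : Measure α} {y : α → Y} {u : α → U}
    (hy : MemLp y 2 μ) (hu : MemLp u 2 μ) :
    Integrable (fun t => supplyRate Q S R (y t) (u t)) μ := by
  have hQS : MemLp (fun t => Q (y t) + S (u t)) 2 μ := (Q.comp_memLp' hy).add (S.comp_memLp' hu)
  have hSR : MemLp (fun t => ContinuousLinearMap.adjoint S (y t) + R (u t)) 2 μ :=
    ((ContinuousLinearMap.adjoint S).comp_memLp' hy).add (R.comp_memLp' hu)
  exact ((integrable_inner_of_memLp ℂ hy hQS).add (integrable_inner_of_memLp ℂ hu hSR)).re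

lemma cost_comp_const_add (y : ℝ → Y) (u : ℝ → U) (a : ℝ) :
    cost Q S R (fun s => y (a + s)) (fun s => u (a + s)) =
      ∫⁻ t in Ici a, ENNReal.ofReal (supplyRate Q S R (y t) (u t)) := by
  simpa only [cost, preimage_const_add_Ici, sub_self] using
    (measurePreserving_add_left volume a).setLIntegral_comp_preimage_emb
      (measurableEmbedding_addLeft a) (fun t => ENNReal.ofReal (supplyRate Q S R (y t) (u t)))
      (Ici a)

variable {Q S R} {N : SystemNode X U Y} {x : ℝ → X} {u : ℝ → U} {y : ℝ → Y}

lemma Val_le_cost (h : IsGeneralizedTrajectory N x u y) : Val N Q S R (x 0) ≤ cost Q S R y u :=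
  sInf_le ⟨x, u, y, h, rfl, rfl⟩

lemma Val_le_ofReal_setIntegral_Ici (hs : ∀ y u, 0 ≤ supplyRate Q S R y u)
    (h : IsGeneralizedTrajectory N x u y) {a : ℝ} (ha : 0 ≤ a)
    (hint : IntegrableOn (fun t => supplyRate Q S R (y t) (u t)) (Ici a)) :
    Val N Q S R (x a) ≤ ENNReal.ofReal (∫ t in Ici a, supplyRate Q S R (y t) (u t)) :=
  calc Val N Q S R (x a)
      = Val N Q S R (x (a + 0)) := by rw [add_zero]
    _ ≤ cost Q S R (fun s => y (a + s)) (fun s => u (a + s)) := Val_le_cost (h.comp_const_add ha)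
    _ = ∫⁻ t in Ici a, ENNReal.ofReal (supplyRate Q S R (y t) (u t)) :=
        cost_comp_const_add Q S R y u a
    _ = ENNReal.ofReal (∫ t in Ici a, supplyRate Q S R (y t) (u t)) :=
        (ofReal_integral_eq_lintegral_ofReal hint (ae_of_all _ fun t => hs (y t) (u t))).symm

end Cost

end SysNode

theorem proposition5p5_general
    {X U Y : Type*}
    [NormedAddCommGroup X] [InnerProductSpace ℂ X]
    [NormedAddCommGroup U] [InnerProductSpace ℂ U] [CompleteSpace U]
    [NormedAddCommGroup Y] [InnerProductSpace ℂ Y] [CompleteSpace Y]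
    {N : SysNode.SystemNode X U Y}
    {Q : Y →L[ℂ] Y} {S : U →L[ℂ] Y} {R : U →L[ℂ] U}
    (hs : ∀ (y : Y) (u : U), 0 ≤ SysNode.supplyRate Q S R y u)
    {x : ℝ → X} {u : ℝ → U} {y : ℝ → Y}
    (htraj : SysNode.IsGeneralizedTrajectory N x u y)
    (hint : IntegrableOn (fun t => SysNode.supplyRate Q S R (y t) (u t)) (Ici 0)) :
    Tendsto (fun t : ℝ => SysNode.Val N Q S R (x t)) atTop (𝓝 0) := by
  have htail : Tendsto
      (fun a => ENNReal.ofReal (∫ t in Ici a, SysNode.supplyRate Q S R (y t) (u t)))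
      atTop (𝓝 0) := by
    simpa only [ENNReal.ofReal_zero] using
      ENNReal.tendsto_ofReal (SysNode.tendsto_setIntegral_Ici_atTop hint)
  refine tendsto_of_tendsto_of_tendsto_of_le_of_le' tendsto_const_nhds htail
    (Eventually.of_forall fun _ => zero_le) ?_
  filter_upwards [eventually_ge_atTop 0] with a ha
  exact SysNode.Val_le_ofReal_setIntegral_Ici hs htraj ha
    (hint.mono_set (Ici_subset_Ici.mpr ha))

theorem proposition5p5
    {X U Y : Type*}
    [NormedAddCommGroup X] [InnerProductSpace ℂ X] [CompleteSpace X]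
    [NormedAddCommGroup U] [InnerProductSpace ℂ U] [CompleteSpace U]
    [NormedAddCommGroup Y] [InnerProductSpace ℂ Y] [CompleteSpace Y]
    (N : SysNode.SystemNode X U Y)
    (Q : Y →L[ℂ] Y) (S : U →L[ℂ] Y) (R : U →L[ℂ] U)
    (hQ : IsSelfAdjoint Q) (hR : IsSelfAdjoint R)
    (hs : ∀ (y : Y) (u : U), 0 ≤ SysNode.supplyRate Q S R y u)
    (hstab : SysNode.IsStateFeedbackStabilizable N)
    (x : ℝ → X) (u : ℝ → U) (y : ℝ → Y)
    (htraj : SysNode.IsGeneralizedTrajectory N x u y)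
    (hu : MemLp u 2 (volume.restrict (Ici (0 : ℝ))))
    (hy : MemLp y 2 (volume.restrict (Ici (0 : ℝ)))) :
    Tendsto (fun t : ℝ => SysNode.Val N Q S R (x t)) atTop (𝓝 0) :=
  proposition5p5_general hs htraj (SysNode.integrable_supplyRate Q S R hy hu)
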